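/- Let $\mathcal X$ be a finite nonempty alphabet, and let $\Gamma$ (the confusion graph) and $\Theta$ (the approximation graph) be simple undirected graphs on $\mathcal X$. For $t\ge 1$ let $\Gamma_t$ and $\Theta_t$ be the graphs on $\mathcal X^t$ in which $x^t,v^t$ are adjacent iff, respectively, $\{x_j,v_j\}\in\mathcal E(\Gamma)$ for some $j$; and $x^t\ne v^t$ and for every $j$, $x_j=v_j$ or $\{x_j,v_j\}\in\mathcal E(\Theta)$. Write $N(G,x)$ for the closed neighborhood of $x$ in $G$, and $\mathcal I(G)$, $\mathcal I_{\max}(G)$ for the independent and the maximal independent sets of $G$. For $T\in\mathcal I_{\max}(\Gamma_t)$ let $\mathcal H_t(T)$ be the hypergraph with vertex set $T$ whose hyperedges are the nonempty sets $T\cap N(\Theta_t,x^t)$, $x^t\in\mathcal X^t$ (for $t=1$, $\Gamma_1=\Gamma$ and $\Theta_1=\Theta$). For a hypergraph $\mathcal H$, $k(\mathcal H)$ is the least number of hyperedges covering all vertices, $k_b(\mathcal H)$ is the least cardinality of a multiset of hyperedges such that each vertex is in at least $b$ of them, and $k_f(\mathcal H)=\inf_{b\ge1}k_b(\mathcal H)/b$.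 Let $\chi_f(\Gamma)=\inf_{b\ge 1}\chi_b(\Gamma)/b$ be the fractional chromatic number, where $\chi_b(\Gamma)$ is the least cardinality of a multiset of independent sets such that each vertex is in exactly $b$ of them. Let $p_f(\Theta)$ be the fractional closed neighborhood packing number, the maximum of $\sum_x\lambda(x)$ over $\lambda:\mathcal X\to[0,1]$ with $\sum_{v\in N(\Theta,x)}\lambda(v)\le1$ for all $x$. Let $g$ be a non-decreasing function from the positive integers to the positive integers with $g(t)\le\max_{T\in\mathcal I_{\max}(\Gamma_t)}k(\mathcal H_t(T))$ for all $t\ge1$, and let $\mathcal S_t=\{\bigcup_{x^t\in K}N(\Theta_t,x^t): K\subseteq\mathcal X^t,\ |K|=g(t)\}$. A mapping scheme $P_{Y|X^t}$ into a discrete code alphabet $\mathcal Y$ is valid if $\{x^t: P_{Y|X^t}(y|x^t)>0\}\in\mathcal I(\Gamma_t)$ for every $y\in\mathcal Y$. Its leakage is $$L^t_{\Theta,g}(P_{Y|X^t})=\log_2\max_{P_X}\frac{\mathbb E_Y\big[\max_{S\in\mathcal S_t}\sum_{x^t\in S}P_{X^t|Y}(x^t|Y)\big]}{\max_{S\in\mathcal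 S_t}\sum_{x^t\in S}P_{X^t}(x^t)},$$ where $P_X$ ranges over the probability distributions on $\mathcal X$ and $P_{X^t}(x^t)=\prod_{j}P_X(x_j)$. Put $\ell_t=\frac1t\inf L^t_{\Theta,g}(P_{Y|X^t})$, the infimum being over all valid mapping schemes. Then $$\log_2\frac{p_f(\Theta)}{\max_{T\in\mathcal I_{\max}(\Gamma)}k_f(\mathcal H_1(T))}\le\liminf_{t\to\infty}\ell_t\qquad\text{and}\qquad\limsup_{t\to\infty}\ell_t\le\log_2\chi_f(\Gamma).$$ In particular, whenever the optimal leakage rate $\mathcal L_{\Theta,g}=\lim_{t\to\infty}\ell_t$ exists, $$\log_2\frac{p_f(\Theta)}{\max_{T\in\mathcal I_{\max}(\Gamma)}k_f(\mathcal H_1(T))}\le\mathcal L_{\Theta,g}\le\log_2\chi_f(\Gamma).$$ -/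

import Mathlib

open Filter Topology

namespace ZeroErrorLeakage

noncomputable section

/-! ### Graphs -/

/-- `T` is a maximal independent set of `G`. -/
def IsMaxIndep {V : Type*} (G : SimpleGraph V) (T : Set V) : Prop :=
  Maximal (fun S : Set V => G.IsIndepSet S) T

/-- The closed neighborhood `N(G, x)`: `x` together with its neighbors. -/
def closedNbhd {V : Type*} (G : SimpleGraph V) (x : V) : Set V :=
  {v | v = x ∨ G.Adj v x}

/-- The `t`-th power of `G` under the OR (disjunctive) product. -/
def orPower {V : Type*} (G : SimpleGraph V) (t : ℕ) : SimpleGraph (Fin t → V) where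
  Adj x v := ∃ j, G.Adj (x j) (v j)
  symm := ⟨fun _ _ ⟨j, h⟩ => ⟨j, h.symm⟩⟩
  loopless := ⟨fun _ ⟨_, h⟩ => h.ne rfl⟩

/-- The `t`-th power of `G` under the AND (strong) product. -/
def andPower {V : Type*} (G : SimpleGraph V) (t : ℕ) : SimpleGraph (Fin t → V) where
  Adj x v := x ≠ v ∧ ∀ j, x j = v j ∨ G.Adj (x j) (v j)
  symm := ⟨fun _ _ ⟨h, h'⟩ => ⟨h.symm, fun j => (h' j).imp Eq.symm fun e => e.symm⟩⟩
  loopless := ⟨fun _ h => h.1 rfl⟩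

open Classical in
/-- A `b`-fold coloring of `G`: a multiset of independent sets such that every vertex lies in
exactly `b` of them, counted with multiplicity. -/
def IsFoldColoring {V : Type*} (G : SimpleGraph V) (b : ℕ) (P : Multiset (Set V)) : Prop :=
  (∀ T ∈ P, G.IsIndepSet T) ∧ ∀ v : V, P.countP (fun T => v ∈ T) = b

/-- The `b`-fold chromatic number `χ_b(G)`. -/
def foldChromaticNumber {V : Type*} (G : SimpleGraph V) (b : ℕ) : ℕ :=
  sInf {m | ∃ P : Multiset (Set V), IsFoldColoring G b P ∧ P.card = m}

/-- The fractional chromatic number `χ_f(G) = inf_{b ≥ 1} χ_b(G) / b`. -/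
def fracChromaticNumber {V : Type*} (G : SimpleGraph V) : ℝ :=
  ⨅ b : ℕ+, (foldChromaticNumber G b : ℝ) / (b : ℕ)

/-- The fractional closed neighborhood packing number `p_f(G)`: the value of the linear program
maximizing the total weight of `w : V → [0, 1]` such that every closed neighborhood has weight at
most `1`. -/
def fracPackingNumber {V : Type*} [Fintype V] (G : SimpleGraph V) : ℝ :=
  sSup {s | ∃ w : V → ℝ, (∀ x, 0 ≤ w x ∧ w x ≤ 1) ∧
    (∀ x, ∑ v, (closedNbhd G x).indicator w v ≤ 1) ∧ s = ∑ x, w x}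

/-! ### Hypergraph coverings -/

/-- A covering of `H`: a finite set of hyperedges whose union is the vertex set. -/
def IsCovering {V : Type*} (H : Hypergraph V) (P : Finset (Set V)) : Prop :=
  (∀ E ∈ P, E ∈ H.edgeSet) ∧ (⋃ E ∈ P, E) = H.vertexSet

/-- The covering number `k(H)`. -/
def coveringNumber {V : Type*} (H : Hypergraph V) : ℕ :=
  sInf {m | ∃ P : Finset (Set V), IsCovering H P ∧ P.card = m}

open Classical in
/-- A `b`-fold covering of `H`: a multiset of hyperedges such that every vertex lies in at least
`b` of them, counted with multiplicity. -/
def IsFoldCovering {V : Type*} (H : Hypergraph V) (b : ℕ) (P : Multiset (Set V)) : Prop :=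
  (∀ E ∈ P, E ∈ H.edgeSet) ∧ ∀ v ∈ H.vertexSet, b ≤ P.countP (fun E => v ∈ E)

/-- The `b`-fold covering number `k_b(H)`. -/
def foldCoveringNumber {V : Type*} (H : Hypergraph V) (b : ℕ) : ℕ :=
  sInf {m | ∃ P : Multiset (Set V), IsFoldCovering H b P ∧ P.card = m}

/-- The fractional covering number `k_f(H) = inf_{b ≥ 1} k_b(H) / b`. -/
def fracCoveringNumber {V : Type*} (H : Hypergraph V) : ℝ :=
  ⨅ b : ℕ+, (foldCoveringNumber H b : ℝ) / (b : ℕ)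

/-- The hypergraph associated with a vertex set `T` and an approximation graph `Θ`: its vertex set
is `T` and its hyperedges are the nonempty intersections of `T` with closed neighborhoods of `Θ`. -/
def assocHypergraph {V : Type*} (Θ : SimpleGraph V) (T : Set V) : Hypergraph V where
  vertexSet := T
  edgeSet := {E | E ⊆ T ∧ E.Nonempty ∧ ∃ x, E = T ∩ closedNbhd Θ x}
  subset_vertexSet_of_mem_edgeSet' := fun _ h => h.1

/-- The largest covering number of the associated hypergraphs over all maximal independent sets. -/
def maxCoveringNumber {V : Type*} (G Θ : SimpleGraph V) : ℕ :=
  ⨆ T : {T : Set V // IsMaxIndep G T}, coveringNumber (assocHypergraph Θ T)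

/-- The largest fractional covering number of the associated hypergraphs over all maximal
independent sets. -/
def maxFracCoveringNumber {V : Type*} (G Θ : SimpleGraph V) : ℝ :=
  ⨆ T : {T : Set V // IsMaxIndep G T}, fracCoveringNumber (assocHypergraph Θ T)

/-! ### Source, mapping schemes and leakage -/

/-- The law of `t` independent symbols drawn from `p` (a memoryless stationary source). -/
def seqLaw {X : Type*} (p : X → ℝ) (t : ℕ) (x : Fin t → X) : ℝ := ∏ j, p (x j)

/-- The law of the codeword when the source law is `p` and the mapping scheme is `W`. -/
def codewordLaw {X : Type*} [Fintype X] {t : ℕ} {Y : Type} (p : X → ℝ) (W : (Fin t → X) → PMF Y) (y : Y) : ℝ :=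
  ∑ x, seqLaw p t x * (W x y).toReal

/-- The conditional law of the source sequence given the codeword `y`. -/
def posteriorLaw {X : Type*} [Fintype X] {t : ℕ} {Y : Type} (p : X → ℝ) (W : (Fin t → X) → PMF Y) (y : Y)
    (x : Fin t → X) : ℝ :=
  seqLaw p t x * (W x y).toReal / codewordLaw p W y

/-- The success probability of the best member of the collection `𝒮` of success sets, when the
sequence has law `q`. -/
def guessProb {X : Type*} [Fintype X] {t : ℕ} (𝒮 : Set (Set (Fin t → X))) (q : (Fin t → X) → ℝ) : ℝ :=
  ⨆ S : 𝒮, ∑ x, (S : Set (Fin t → X)).indicator q x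

/-- The expected success probability after observing the codeword. -/
def posteriorGuessProb {X : Type*} [Fintype X] {t : ℕ} {Y : Type} (𝒮 : Set (Set (Fin t → X))) (p : X → ℝ)
    (W : (Fin t → X) → PMF Y) : ℝ :=
  ∑' y, codewordLaw p W y * guessProb 𝒮 (posteriorLaw p W y)

/-- The leakage `ρ_t(W, 𝒮)`: the base-two logarithm of the ratio of the success probabilities after
and before observing the codeword, maximized over the source distribution on the alphabet. -/
def leakage {X : Type*} [Fintype X] {t : ℕ} {Y : Type} (W : (Fin t → X) → PMF Y) (𝒮 : Set (Set (Fin t → X))) : ℝ :=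
  Real.logb 2 (⨆ p : stdSimplex ℝ X, posteriorGuessProb 𝒮 p W / guessProb 𝒮 (seqLaw p t))

/-- A mapping scheme is valid if the sequences that can be mapped to the same codeword always form
an independent set of the confusion graph for sequences. -/
def IsValid {X : Type*} {t : ℕ} {Y : Type} (Γ : SimpleGraph X) (W : (Fin t → X) → PMF Y) : Prop :=
  ∀ y, (orPower Γ t).IsIndepSet {x | 0 < W x y}

/-- The success sets of an adversary making `n` guesses: the unions of the closed neighborhoods, in
the approximation graph for sequences, of `n` distinct sequences. -/
def successSets {X : Type*} (Θ : SimpleGraph X) (t n : ℕ) : Set (Set (Fin t → X)) :=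
  {S | ∃ K : Finset (Fin t → X), K.card = n ∧ S = ⋃ x ∈ K, closedNbhd (andPower Θ t) x}

/-- `g` is a guessing capability function for the confusion graph `Γ` and the approximation graph
`Θ`; only positive sequence lengths matter. -/
structure IsGuessingCapability {X : Type*} (Γ Θ : SimpleGraph X) (g : ℕ → ℕ) : Prop where
  pos : ∀ t, 1 ≤ t → 1 ≤ g t
  mono : ∀ s t, 1 ≤ s → s ≤ t → g s ≤ g t
  le_covering : ∀ t, 1 ≤ t → g t ≤ maxCoveringNumber (orPower Γ t) (andPower Θ t)

/-- The smallest leakage over all valid mapping schemes of sequences of length `t`, with an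
arbitrary discrete code alphabet, to an adversary making `g t` approximate guesses. -/
def optLeakage {X : Type*} [Fintype X] (Γ Θ : SimpleGraph X) (g : ℕ → ℕ) (t : ℕ) : ℝ :=
  sInf {r | ∃ (Y : Type) (W : (Fin t → X) → PMF Y), IsValid Γ W ∧
    r = leakage W (successSets Θ t (g t))}

/-- The normalized optimal leakage `t⁻¹ · optLeakage`. -/
def normLeakage {X : Type*} [Fintype X] (Γ Θ : SimpleGraph X) (g : ℕ → ℕ) (t : ℕ) : ℝ :=
  (t : ℝ)⁻¹ * optLeakage Γ Θ g t

/-- `L` is the optimal multi-approximate-guess maximal leakage rate: the limit of the normalized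
optimal leakages. -/
def IsLeakageRate {X : Type*} [Fintype X] (Γ Θ : SimpleGraph X) (g : ℕ → ℕ) (L : ℝ) : Prop :=
  Tendsto (normLeakage Γ Θ g) atTop (𝓝 L)

end

end ZeroErrorLeakage

namespace ZeroErrorLeakage

/-! Upper bound: fix a `b`-fold coloring with `m` classes and send each letter, independently, to a
uniformly random one of its `b` classes. The sequences sharing a codeword have, in each coordinate,
letters from one independent set, so the scheme is valid. Every codeword has conditional probability
at most `b⁻ᵗ`, so each of the `mᵗ` codewords contributes at most `b⁻ᵗ` times the prior guessing
probability, whatever the source. The leakage is at most `t log (m / b)`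
(`exists_valid_leakage_le`).

Lower bound: test a valid scheme on the source proportional to a packing `w` of total weight `s`.
Closed neighborhoods in the strong power are products, so each has prior mass at most `s⁻ᵗ`, and `k`
guesses succeed with probability at most `k s⁻ᵗ`. After a codeword is seen, the support is
independent in the OR power, so its coordinate projections are independent in `Γ`. Products of
fractional coverings of these projections have weight at most `Mᵗ` for any `M` above the largest
fractional covering number, and greedy choice turns such a product into a genuine covering by `n ≈
Mᵗ · t log |X|` neighborhoods (`exists_cover_orPower`). The best `k` of them keep a fraction `k / n`
of the mass (`exists_card_eq_mul_sum_le`). The factor `k` cancels, leaving leakage at least `log (sᵗ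
/ n)`; the factor `t log |X|` disappears after normalization, and `s`, `M` tend to their optimal
values. -/

open Classical in
/-- The sum of a product weight over a product set factorizes. -/
theorem sum_indicator_pi {X : Type*} [Fintype X] {t : ℕ} (A : Fin t → Set X)
    (w : Fin t → X → ℝ) :
    ∑ x : Fin t → X, {x : Fin t → X | ∀ j, x j ∈ A j}.indicator (fun x => ∏ j, w j (x j)) x =
      ∏ j, ∑ a, (A j).indicator (w j) a := by
  rw [Finset.prod_univ_sum, Fintype.piFinset_univ]
  refine Finset.sum_congr rfl fun x _ => ?_
  by_cases h : ∀ j, x j ∈ A j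
  · rw [Set.indicator_of_mem (by exact h)]
    exact Finset.prod_congr rfl fun j _ => (Set.indicator_of_mem (h j) _).symm
  · rw [Set.indicator_of_notMem (by exact h)]
    push Not at h
    obtain ⟨j, hj⟩ := h
    exact (Finset.prod_eq_zero (Finset.mem_univ j) (Set.indicator_of_notMem hj _)).symm

theorem closedNbhd_andPower {X : Type*} (Θ : SimpleGraph X) {t : ℕ} (x : Fin t → X) :
    closedNbhd (andPower Θ t) x = {v | ∀ j, v j ∈ closedNbhd Θ (x j)} := by
  ext v
  constructor
  · rintro (rfl | h) j
    · exact Or.inl rfl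
    · exact h.2 j
  · intro h
    by_cases e : v = x
    · exact Or.inl e
    · exact Or.inr ⟨e, h⟩

theorem self_mem_closedNbhd {V : Type*} (G : SimpleGraph V) (x : V) : x ∈ closedNbhd G x :=
  Or.inl rfl

theorem mem_closedNbhd_comm {V : Type*} (G : SimpleGraph V) {x v : V} :
    v ∈ closedNbhd G x ↔ x ∈ closedNbhd G v := by
  constructor <;> rintro (h | h)
  · exact Or.inl h.symm
  · exact Or.inr h.symm
  · exact Or.inl h.symm
  · exact Or.inr h.symm

theorem exists_isMaxIndep_superset {V : Type*} [Finite V] (G : SimpleGraph V) {S : Set V}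
    (hS : G.IsIndepSet S) : ∃ T, S ⊆ T ∧ IsMaxIndep G T :=
  (Set.toFinite {S : Set V | G.IsIndepSet S}).exists_le_maximal hS

theorem isIndepSet_singleton {V : Type*} (G : SimpleGraph V) (v : V) : G.IsIndepSet {v} :=
  Set.pairwise_singleton _ _

/-- Indexing a multiset by `Fin` turns multiplicity counts into cardinalities of filtered index
sets. -/
theorem exists_fin_map_eq {α : Type*} (P : Multiset α) :
    ∃ f : Fin P.card → α, (Finset.univ : Finset (Fin P.card)).val.map f = P := by
  induction P using Quotient.inductionOn with
  | h l => exact ⟨l.get, (Fin.univ_val_map l.get).trans (congrArg _ (List.ofFn_get l))⟩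

/-! ### Colorings -/

theorem exists_isFoldColoring {V : Type*} [Finite V] (G : SimpleGraph V) (b : ℕ) :
    ∃ P : Multiset (Set V), IsFoldColoring G b P := by
  classical
  have := Fintype.ofFinite V
  -- The singletons, each repeated `b` times; feasibility is what makes the `sInf` defining
  -- `foldChromaticNumber` an attained minimum instead of the default `0`.
  refine ⟨(b • (Finset.univ : Finset V).val).map fun v => {v}, ?_, fun v => ?_⟩
  · intro T hT
    obtain ⟨v, -, rfl⟩ := Multiset.mem_map.1 hT
    exact isIndepSet_singleton G v
  · rw [Multiset.map_nsmul, Multiset.countP_nsmul, Multiset.countP_map]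
    have h : (Finset.univ.filter fun a : V => v ∈ ({a} : Set V)).card = 1 := by
      simp [Finset.filter_eq]
    refine Eq.trans ?_ (mul_one b)
    congr 1

open Classical in
theorem exists_coloring_family {V : Type*} [Finite V] (G : SimpleGraph V) (b : ℕ) :
    ∃ A : Fin (foldChromaticNumber G b) → Set V, (∀ i, G.IsIndepSet (A i)) ∧
      ∀ v, (Finset.univ.filter fun i => v ∈ A i).card = b := by
  obtain ⟨P, hP⟩ := exists_isFoldColoring G b
  obtain ⟨P, hP, hc⟩ : foldChromaticNumber G b ∈
      {m | ∃ P : Multiset (Set V), IsFoldColoring G b P ∧ P.card = m} :=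
    Nat.sInf_mem ⟨_, P, hP, rfl⟩
  rw [← hc]
  obtain ⟨f, hf⟩ := exists_fin_map_eq P
  refine ⟨f, fun i => hP.1 _ ?_, fun v => ?_⟩
  · rw [← hf]
    exact Multiset.mem_map_of_mem _ (Finset.mem_univ i)
  · have := hP.2 v
    rw [← hf, Multiset.countP_map] at this
    exact this

theorem le_foldChromaticNumber {V : Type*} [Finite V] [Nonempty V] (G : SimpleGraph V) (b : ℕ) :
    b ≤ foldChromaticNumber G b := by
  classical
  obtain ⟨A, -, h⟩ := exists_coloring_family G b
  obtain ⟨v⟩ := ‹Nonempty V›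
  calc b = _ := (h v).symm
    _ ≤ _ := Finset.card_filter_le _ _
    _ = _ := by simp

/-! ### Coverings -/

theorem exists_isFoldCovering {V : Type*} [Finite V] (Θ : SimpleGraph V) (T : Set V) (b : ℕ) :
    ∃ P : Multiset (Set V), IsFoldCovering (assocHypergraph Θ T) b P := by
  classical
  have := Fintype.ofFinite V
  refine ⟨b • (T.toFinset.val.map fun v => T ∩ closedNbhd Θ v), ?_, fun v hv => ?_⟩
  · intro E hE
    obtain ⟨v, hv, rfl⟩ := Multiset.mem_map.1 (Multiset.mem_of_mem_nsmul hE)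
    have hv : v ∈ T := by simpa using hv
    exact ⟨Set.inter_subset_left, ⟨v, hv, self_mem_closedNbhd Θ v⟩, v, rfl⟩
  · replace hv : v ∈ T := hv
    rw [Multiset.countP_nsmul]
    refine Nat.le_mul_of_pos_right _ (Multiset.countP_pos.2 ⟨T ∩ closedNbhd Θ v, ?_, hv,
      self_mem_closedNbhd Θ v⟩)
    exact Multiset.mem_map_of_mem _ (by simpa using hv)

-- An optimal covering is recorded by neighborhood centers, so that the intersection with `T` can be
-- forgotten.
open Classical in
theorem exists_covering_family {V : Type*} [Finite V] (Θ : SimpleGraph V) (T : Set V) (b : ℕ) :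
    ∃ c : Fin (foldCoveringNumber (assocHypergraph Θ T) b) → V,
      ∀ v ∈ T, b ≤ (Finset.univ.filter fun i => v ∈ closedNbhd Θ (c i)).card := by
  obtain ⟨P, hP⟩ := exists_isFoldCovering Θ T b
  obtain ⟨P, hP, hc⟩ : foldCoveringNumber (assocHypergraph Θ T) b ∈
      {m | ∃ P : Multiset (Set V), IsFoldCovering (assocHypergraph Θ T) b P ∧ P.card = m} :=
    Nat.sInf_mem ⟨_, P, hP, rfl⟩
  rw [← hc]
  obtain ⟨f, hf⟩ := exists_fin_map_eq P
  have hmem : ∀ i, f i ∈ (assocHypergraph Θ T).edgeSet := fun i => hP.1 _ <| by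
    rw [← hf]
    exact Multiset.mem_map_of_mem _ (Finset.mem_univ i)
  choose c hc using fun i => (hmem i).2.2
  refine ⟨c, fun v hv => ?_⟩
  have := hP.2 v hv
  rw [← hf, Multiset.countP_map] at this
  refine this.trans (Finset.card_le_card (s := Finset.univ.filter fun i => v ∈ f i) ?_)
  intro i hi
  simp only [Finset.mem_filter, Finset.mem_univ, true_and] at hi ⊢
  rw [hc i] at hi
  exact hi.2

theorem le_foldCoveringNumber {V : Type*} [Finite V] (Θ : SimpleGraph V) {T : Set V}
    (hT : T.Nonempty) (b : ℕ) : b ≤ foldCoveringNumber (assocHypergraph Θ T) b := by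
  classical
  obtain ⟨c, h⟩ := exists_covering_family Θ T b
  obtain ⟨v, hv⟩ := hT
  calc b ≤ _ := h v hv
    _ ≤ _ := Finset.card_filter_le _ _
    _ = _ := by simp

theorem fracCoveringNumber_le_max {V : Type*} [Finite V] (Γ Θ : SimpleGraph V) {T : Set V}
    (hT : IsMaxIndep Γ T) :
    fracCoveringNumber (assocHypergraph Θ T) ≤ maxFracCoveringNumber Γ Θ :=
  le_ciSup (f := fun T : {T : Set V // IsMaxIndep Γ T} =>
    fracCoveringNumber (assocHypergraph Θ T.1)) (Set.finite_range _).bddAbove ⟨T, hT⟩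

theorem one_le_maxFracCoveringNumber {V : Type*} [Finite V] [Nonempty V] (Γ Θ : SimpleGraph V) :
    1 ≤ maxFracCoveringNumber Γ Θ := by
  obtain ⟨v⟩ := ‹Nonempty V›
  obtain ⟨T, hvT, hT⟩ := exists_isMaxIndep_superset Γ (isIndepSet_singleton Γ v)
  refine le_trans ?_ (fracCoveringNumber_le_max Γ Θ hT)
  refine le_ciInf fun b => ?_
  rw [one_le_div (by exact_mod_cast b.pos)]
  exact_mod_cast le_foldCoveringNumber Θ ⟨v, hvT rfl⟩ b

/-- Fractional coverings as weights on the centers of the closed neighborhoods. -/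
theorem exists_cover_weight {V : Type*} [Fintype V] (Γ Θ : SimpleGraph V) {T : Set V}
    (hT : Γ.IsIndepSet T) {M : ℝ} (hM : maxFracCoveringNumber Γ Θ < M) :
    ∃ w : V → ℝ, (∀ x, 0 ≤ w x) ∧ ∑ x, w x ≤ M ∧
      ∀ v ∈ T, 1 ≤ ∑ x, (closedNbhd Θ v).indicator w x := by
  classical
  obtain ⟨T', hTT', hT'⟩ := exists_isMaxIndep_superset Γ hT
  -- The strict inequality on `M` supplies an actual `b`, without knowing that the infimum is
  -- attained.
  obtain ⟨b, hb⟩ := exists_lt_of_ciInf_lt ((fracCoveringNumber_le_max Γ Θ hT').trans_lt hM)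
  obtain ⟨c, hc⟩ := exists_covering_family Θ T' b
  have hb0 : (0 : ℝ) < (b : ℕ) := by exact_mod_cast b.pos
  -- The weight of `x` is the number of hyperedges centered at `x`, divided by `b`.
  refine ⟨fun x => ((Finset.univ.filter fun i => c i = x).card : ℝ) / (b : ℕ),
    fun x => by positivity, ?_, fun v hv => ?_⟩
  · have h := Finset.card_eq_sum_card_fiberwise (f := c) (s := Finset.univ) (t := Finset.univ)
      (fun _ _ => Finset.mem_coe.2 (Finset.mem_univ _))
    rw [← Finset.sum_div, ← Nat.cast_sum, ← h]
    simpa using hb.le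
  · have h := hc v (hTT' hv)
    rw [Finset.card_eq_sum_card_fiberwise (f := c) (t := Finset.univ)
      (fun _ _ => Finset.mem_coe.2 (Finset.mem_univ _))] at h
    have h' : ((b : ℕ) : ℝ) ≤ ∑ x, (closedNbhd Θ v).indicator
        (fun x => ((Finset.univ.filter fun i => c i = x).card : ℝ)) x := by
      refine le_trans (Nat.cast_le.2 h) ?_
      rw [Nat.cast_sum]
      refine Finset.sum_le_sum fun x _ => ?_
      by_cases hx : x ∈ closedNbhd Θ v
      · rw [Set.indicator_of_mem hx, Nat.cast_le]
        refine Finset.card_le_card fun i hi => ?_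
        simp only [Finset.mem_filter, Finset.mem_univ, true_and] at hi ⊢
        exact hi.2
      · rw [Set.indicator_of_notMem hx, Finset.card_eq_zero.2, Nat.cast_zero]
        refine Finset.filter_eq_empty_iff.2 fun i hi e => hx ?_
        rw [Finset.mem_filter] at hi
        rw [← e, mem_closedNbhd_comm]
        exact hi.2
    calc (1 : ℝ) ≤ (∑ x, (closedNbhd Θ v).indicator
          (fun x => ((Finset.univ.filter fun i => c i = x).card : ℝ)) x) / (b : ℕ) :=
          (one_le_div hb0).2 h'
      _ = _ := by
        rw [Finset.sum_div]
        refine Finset.sum_congr rfl fun x _ => ?_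
        by_cases hx : x ∈ closedNbhd Θ v <;> simp [hx]

/-! ### Greedy coverings and coverings in graph powers -/

open Classical in
/-- Greedy covering: `n` closed neighborhoods leave at most a fraction `(1 - 1 / M) ^ n` of the
vertices uncovered when there is a fractional covering of weight at most `M`. -/
theorem exists_greedy_cover {V : Type*} [Fintype V] [Nonempty V] (G : SimpleGraph V) (T : Finset V)
    (w : V → ℝ) (hw : ∀ x, 0 ≤ w x) {M : ℝ} (hM1 : 1 ≤ M) (hM : ∑ x, w x ≤ M)
    (hcov : ∀ v ∈ T, 1 ≤ ∑ x, (closedNbhd G v).indicator w x) (n : ℕ) :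
    ∃ K : Finset V, K.card ≤ n ∧
      ((T.filter fun v => ∀ x ∈ K, v ∉ closedNbhd G x).card : ℝ) ≤ T.card * (1 - 1 / M) ^ n := by
  have hM0 : 0 < M := by linarith
  have hM2 : 0 ≤ 1 - 1 / M := by
    rw [sub_nonneg, div_le_one hM0]
    exact hM1
  induction n with
  | zero => exact ⟨∅, by simp, by simp⟩
  | succ n ih =>
    obtain ⟨K, hK, hR⟩ := ih
    set R := T.filter fun v => ∀ x ∈ K, v ∉ closedNbhd G x with hRdef
    -- Greedy choice: `z` covers the most vertices among those still uncovered.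
    obtain ⟨z, -, hz⟩ := Finset.exists_max_image (Finset.univ : Finset V)
      (fun x => (R.filter fun v => v ∈ closedNbhd G x).card) Finset.univ_nonempty
    set D := (R.filter fun v => v ∈ closedNbhd G z).card with hD
    -- Double counting: the fractional covering gives each remaining vertex weight at least `1`,
    -- while each center serves at most `D` of them. So `z` removes at least a fraction `1 / M` of
    -- `R`.
    have key : (R.card : ℝ) ≤ M * D := by
      calc (R.card : ℝ) = ∑ v ∈ R, (1 : ℝ) := by simp
        _ ≤ ∑ v ∈ R, ∑ x, (closedNbhd G v).indicator w x :=
            Finset.sum_le_sum fun v hv => hcov v (Finset.mem_filter.1 hv).1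
        _ = ∑ x, ∑ v ∈ R, (closedNbhd G v).indicator w x := Finset.sum_comm
        _ = ∑ x, w x * (R.filter fun v => v ∈ closedNbhd G x).card := by
            refine Finset.sum_congr rfl fun x _ => ?_
            rw [Finset.natCast_card_filter, Finset.mul_sum]
            refine Finset.sum_congr rfl fun v _ => ?_
            rw [Set.indicator_apply, mul_ite, mul_one, mul_zero]
            simp only [mem_closedNbhd_comm G (x := v)]
        _ ≤ ∑ x, w x * D := Finset.sum_le_sum fun x hx =>
            mul_le_mul_of_nonneg_left (Nat.cast_le.2 (hz x hx)) (hw x)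
        _ = (∑ x, w x) * D := by rw [Finset.sum_mul]
        _ ≤ M * D := mul_le_mul_of_nonneg_right hM (Nat.cast_nonneg _)
    refine ⟨insert z K, (Finset.card_insert_le _ _).trans (by omega), ?_⟩
    have hsplit := Finset.card_filter_add_card_filter_not (s := R) (fun v => v ∈ closedNbhd G z)
    have hnew : (T.filter fun v => ∀ x ∈ insert z K, v ∉ closedNbhd G x) =
        R.filter fun v => v ∉ closedNbhd G z := by
      ext v
      simp only [hRdef, Finset.mem_filter, Finset.mem_insert, forall_eq_or_imp]
      tauto
    rw [hnew]
    have hs : (D : ℝ) + ((R.filter fun v => v ∉ closedNbhd G z).card : ℝ) = R.card := by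
      exact_mod_cast hsplit
    have hDM : (R.card : ℝ) * (1 / M) ≤ D := by
      rw [mul_one_div, div_le_iff₀ hM0]
      linarith
    calc ((R.filter fun v => v ∉ closedNbhd G z).card : ℝ) ≤ R.card * (1 - 1 / M) := by
          rw [mul_sub, mul_one]
          linarith
      _ ≤ T.card * (1 - 1 / M) ^ n * (1 - 1 / M) := mul_le_mul_of_nonneg_right hR hM2
      _ = _ := by ring

/-- Since `(1 - 1/M) ^ n ≤ exp (-n/M)`, the greedy remainder has fewer than one element, hence is
empty. -/
theorem exists_cover_card_le {V : Type*} [Fintype V] [Nonempty V] (G : SimpleGraph V) (T : Set V)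
    (w : V → ℝ) (hw : ∀ x, 0 ≤ w x) {M : ℝ} (hM1 : 1 ≤ M) (hM : ∑ x, w x ≤ M)
    (hcov : ∀ v ∈ T, 1 ≤ ∑ x, (closedNbhd G v).indicator w x) {n : ℕ}
    (hn : M * Real.log (Fintype.card V) < n) :
    ∃ K : Finset V, K.card ≤ n ∧ ∀ v ∈ T, ∃ x ∈ K, v ∈ closedNbhd G x := by
  classical
  have hM0 : 0 < M := by linarith
  obtain ⟨K, hK, h⟩ := exists_greedy_cover G T.toFinset w hw hM1 hM
    (fun v hv => hcov v (by simpa using hv)) n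
  refine ⟨K, hK, fun v hv => ?_⟩
  have hV : (0 : ℝ) < Fintype.card V := by exact_mod_cast Fintype.card_pos
  have h1 : (T.toFinset.card : ℝ) * (1 - 1 / M) ^ n < 1 := by
    calc (T.toFinset.card : ℝ) * (1 - 1 / M) ^ n
        ≤ Fintype.card V * Real.exp (-(1 / M)) ^ n := by
          have h0 : 0 ≤ 1 - 1 / M := by
            rw [sub_nonneg, div_le_one hM0]
            exact hM1
          have h1 : 1 - 1 / M ≤ Real.exp (-(1 / M)) := by
            linarith [Real.add_one_le_exp (-(1 / M))]
          gcongr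
          exact Finset.card_le_univ _
      _ = Real.exp (Real.log (Fintype.card V) - n / M) := by
          rw [sub_eq_add_neg, Real.exp_add, Real.exp_log hV, ← Real.exp_nat_mul]
          congr 2
          ring
      _ < 1 := by
          rw [Real.exp_lt_one_iff, sub_neg, lt_div_iff₀ hM0]
          linarith
  by_contra! hne
  have : 1 ≤ (T.toFinset.filter fun v => ∀ x ∈ K, v ∉ closedNbhd G x).card :=
    Finset.card_pos.2 ⟨v, Finset.mem_filter.2 ⟨by simpa using hv, hne⟩⟩
  have : (1 : ℝ) ≤ _ := Nat.one_le_cast.2 this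
  linarith

/-- Independent sets of the power of the confusion graph are covered by few closed neighborhoods. -/
theorem exists_cover_orPower {X : Type*} [Fintype X] [Nonempty X] (Γ Θ : SimpleGraph X) {M : ℝ}
    (hM : maxFracCoveringNumber Γ Θ < M) {t n : ℕ}
    (hn : M ^ t * (t * Real.log (Fintype.card X)) < n) {S : Set (Fin t → X)}
    (hS : (orPower Γ t).IsIndepSet S) :
    ∃ K : Finset (Fin t → X), K.card ≤ n ∧
      ∀ v ∈ S, ∃ x ∈ K, v ∈ closedNbhd (andPower Θ t) x := by
  classical
  have hM1 : 1 ≤ M := (one_le_maxFracCoveringNumber Γ Θ).trans hM.le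
  -- An edge of `Γ` in a single coordinate already makes two sequences adjacent in the OR power.
  have hproj : ∀ j, Γ.IsIndepSet ((fun x : Fin t → X => x j) '' S) := by
    rintro j _ ⟨x, hx, rfl⟩ _ ⟨v, hv, rfl⟩ - hadj
    have hxv : x ≠ v := by
      rintro rfl
      exact hadj.ne rfl
    exact hS hx hv hxv ⟨j, hadj⟩
  choose w hw hwM hcov using fun j => exists_cover_weight Γ Θ (hproj j) hM
  refine exists_cover_card_le (andPower Θ t) S (fun x => ∏ j, w j (x j))
    (fun x => Finset.prod_nonneg fun j _ => hw j _) (M := M ^ t) (one_le_pow₀ hM1) ?_ ?_ ?_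
  · have := sum_indicator_pi (fun _ : Fin t => (Set.univ : Set X)) w
    simp only [Set.mem_univ, implies_true, Set.ofPred_true, Set.indicator_univ] at this
    rw [this]
    calc ∏ j, ∑ a, w j a ≤ ∏ _j : Fin t, M :=
          Finset.prod_le_prod (fun j _ => Finset.sum_nonneg fun a _ => hw j a) fun j _ => hwM j
      _ = M ^ t := by simp
  · intro v hv
    rw [closedNbhd_andPower, sum_indicator_pi]
    rw [← Finset.prod_const_one (s := (Finset.univ : Finset (Fin t)))]
    exact Finset.prod_le_prod (fun _ _ => zero_le_one) fun j _ => hcov j _ ⟨v, hv, rfl⟩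
  · simpa [Real.log_pow] using hn

theorem coveringNumber_le {V : Type*} (Θ : SimpleGraph V) {T : Set V} (K : Finset V)
    (hK : ∀ v ∈ T, ∃ x ∈ K, v ∈ closedNbhd Θ x) :
    coveringNumber (assocHypergraph Θ T) ≤ K.card := by
  classical
  -- Empty intersections are discarded because they are not hyperedges.
  let P := (K.image fun x => T ∩ closedNbhd Θ x).filter Set.Nonempty
  have hP : IsCovering (assocHypergraph Θ T) P := by
    constructor
    · intro E hE
      obtain ⟨h1, h2⟩ := Finset.mem_filter.1 hE
      obtain ⟨x, -, rfl⟩ := Finset.mem_image.1 h1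
      exact ⟨Set.inter_subset_left, h2, x, rfl⟩
    · change _ = T
      refine Set.Subset.antisymm (Set.iUnion₂_subset fun E hE => ?_) fun v hv => ?_
      · obtain ⟨x, -, rfl⟩ := Finset.mem_image.1 (Finset.mem_filter.1 hE).1
        exact Set.inter_subset_left
      · obtain ⟨x, hx, hvx⟩ := hK v hv
        exact Set.mem_iUnion₂.2 ⟨T ∩ closedNbhd Θ x, Finset.mem_filter.2
          ⟨Finset.mem_image_of_mem _ hx, ⟨v, hv, hvx⟩⟩, hv, hvx⟩
  have h : coveringNumber (assocHypergraph Θ T) ≤ P.card := Nat.sInf_le ⟨P, hP, rfl⟩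
  exact h.trans ((Finset.card_filter_le _ _).trans Finset.card_image_le)

theorem maxCoveringNumber_le {V : Type*} (G Θ : SimpleGraph V) {n : ℕ}
    (h : ∀ T, G.IsIndepSet T → ∃ K : Finset V, K.card ≤ n ∧
      ∀ v ∈ T, ∃ x ∈ K, v ∈ closedNbhd Θ x) :
    maxCoveringNumber G Θ ≤ n := by
  refine ciSup_le' fun T => ?_
  obtain ⟨K, hK, hc⟩ := h T.1 T.2.prop
  exact (coveringNumber_le Θ K hc).trans hK

theorem maxCoveringNumber_le_card {V : Type*} [Fintype V] (G Θ : SimpleGraph V) :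
    maxCoveringNumber G Θ ≤ Fintype.card V :=
  maxCoveringNumber_le G Θ fun _ _ => ⟨Finset.univ, le_rfl, fun v _ =>
    ⟨v, Finset.mem_univ v, self_mem_closedNbhd Θ v⟩⟩

/-! ### Keeping a share of the mass with fewer neighborhoods -/

/-- Some subset of prescribed size carries at least its proportional share of the total weight. -/
theorem exists_subset_card_eq_mul_sum_le {α : Type*} (K : Finset α) (f : α → ℝ) {j : ℕ}
    (hj : j ≤ K.card) :
    ∃ K' ⊆ K, K'.card = j ∧ (j : ℝ) * ∑ x ∈ K, f x ≤ K.card * ∑ x ∈ K', f x := by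
  classical
  induction hj using Nat.decreasingInduction with
  | self => exact ⟨K, subset_rfl, rfl, le_rfl⟩
  | of_succ j hj ih =>
    obtain ⟨K', hK', hc, hle⟩ := ih
    -- Descending from the full set, deleting an element of least weight never lowers the average.
    obtain ⟨a, ha, hmin⟩ := Finset.exists_min_image K' f (Finset.card_pos.1 (by omega))
    refine ⟨K'.erase a, (Finset.erase_subset _ _).trans hK', by
      rw [Finset.card_erase_of_mem ha, hc, Nat.add_sub_cancel], ?_⟩
    have h1 : ((j : ℝ) + 1) * f a ≤ ∑ x ∈ K', f x := by
      have := Finset.card_nsmul_le_sum K' f (f a) hmin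
      rw [hc, nsmul_eq_mul] at this
      exact_mod_cast this
    have h2 := Finset.add_sum_erase K' f ha
    push_cast at hle
    have hK0 : (0 : ℝ) ≤ K.card := Nat.cast_nonneg _
    have hj0 : (0 : ℝ) ≤ j := Nat.cast_nonneg _
    refine le_of_mul_le_mul_left (a := (j : ℝ) + 1) ?_ (by positivity)
    have e : ∑ x ∈ K'.erase a, f x = ∑ x ∈ K', f x - f a := by linarith
    rw [e]
    nlinarith [mul_le_mul_of_nonneg_left h1 hK0, mul_le_mul_of_nonneg_left hle hj0]

/-- If `n` closed neighborhoods cover the support of `q`, then some `k ≤ n` closed neighborhoods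
carry a fraction `k / n` of the mass of `q`. -/
theorem exists_card_eq_mul_sum_le {V : Type*} [Fintype V] (G : SimpleGraph V) {q : V → ℝ}
    (hq : ∀ x, 0 ≤ q x) {K : Finset V} {k n : ℕ} (hKn : K.card ≤ n) (hkn : k ≤ n)
    (hkV : k ≤ Fintype.card V) (hcov : ∀ v, q v ≠ 0 → ∃ x ∈ K, v ∈ closedNbhd G x) :
    ∃ K' : Finset V, K'.card = k ∧
      (k : ℝ) * ∑ x, q x ≤ n * ∑ x, (⋃ z ∈ K', closedNbhd G z).indicator q x := by
  classical
  have hq0 : 0 ≤ ∑ x, q x := Finset.sum_nonneg fun x _ => hq x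
  rcases le_total K.card k with h | h
  -- With `k` guesses to spare, the covering is padded and captures all the mass.
  · obtain ⟨K', hKK', hc⟩ := Finset.exists_superset_card_eq h hkV
    refine ⟨K', hc, ?_⟩
    have : ∑ x, (⋃ z ∈ K', closedNbhd G z).indicator q x = ∑ x, q x := by
      refine Finset.sum_congr rfl fun v _ => Set.indicator_apply_eq_self.2 fun hv => ?_
      by_contra hne
      obtain ⟨x, hx, hvx⟩ := hcov v hne
      exact hv (Set.mem_iUnion₂.2 ⟨x, hKK' hx, hvx⟩)
    rw [this]
    exact mul_le_mul_of_nonneg_right (Nat.cast_le.2 hkn) hq0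
  · have : ∀ v, ∃ x, q v ≠ 0 → x ∈ K ∧ v ∈ closedNbhd G x := fun v => by
      by_cases hv : q v = 0
      · exact ⟨v, fun h => (h hv).elim⟩
      · obtain ⟨x, hx⟩ := hcov v hv
        exact ⟨x, fun _ => hx⟩
    -- Assigning each support point to one center that covers it splits the mass of `q` among the
    -- centers without overlap; points off the support carry no mass.
    choose c hc using this
    obtain ⟨K', -, hK'c, hle⟩ :=
      exists_subset_card_eq_mul_sum_le K (fun x => ∑ v, if c v = x then q v else 0) h
    refine ⟨K', hK'c, ?_⟩
    have e1 : ∑ x ∈ K, (∑ v, if c v = x then q v else 0) = ∑ v, q v := by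
      rw [Finset.sum_comm]
      refine Finset.sum_congr rfl fun v _ => ?_
      rw [Finset.sum_ite_eq]
      split_ifs with hv
      · rfl
      · by_contra hne
        exact hv (hc v (Ne.symm hne)).1
    have e2 : ∑ x ∈ K', (∑ v, if c v = x then q v else 0) ≤
        ∑ x, (⋃ z ∈ K', closedNbhd G z).indicator q x := by
      rw [Finset.sum_comm]
      refine Finset.sum_le_sum fun v _ => ?_
      rw [Finset.sum_ite_eq]
      split_ifs with hv
      · by_cases h0 : q v = 0
        · rw [h0]
          exact Set.indicator_nonneg (fun x _ => hq x) v
        · rw [Set.indicator_of_mem (Set.mem_iUnion₂.2 ⟨c v, hv, (hc v h0).2⟩)]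
      · exact Set.indicator_nonneg (fun x _ => hq x) v
    rw [e1] at hle
    have e3 : 0 ≤ ∑ x, (⋃ z ∈ K', closedNbhd G z).indicator q x :=
      Finset.sum_nonneg fun x _ => Set.indicator_nonneg (fun x _ => hq x) x
    calc (k : ℝ) * ∑ x, q x ≤ _ := hle
      _ ≤ K.card * ∑ x, (⋃ z ∈ K', closedNbhd G z).indicator q x :=
          mul_le_mul_of_nonneg_left e2 (Nat.cast_nonneg _)
      _ ≤ _ := mul_le_mul_of_nonneg_right (Nat.cast_le.2 hKn) e3

/-! ### Guessing probabilities and leakage -/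

section Guessing

variable {X : Type*} [Fintype X] {t : ℕ} {𝒮 : Set (Set (Fin t → X))} {q : (Fin t → X) → ℝ}

theorem guessProb_nonneg (𝒮 : Set (Set (Fin t → X))) (hq : ∀ x, 0 ≤ q x) : 0 ≤ guessProb 𝒮 q :=
  Real.iSup_nonneg fun _ => Finset.sum_nonneg fun x _ => Set.indicator_nonneg (fun x _ => hq x) x

theorem le_guessProb {S : Set (Fin t → X)} (hS : S ∈ 𝒮) (q : (Fin t → X) → ℝ) :
    ∑ x, S.indicator q x ≤ guessProb 𝒮 q :=
  le_ciSup (f := fun S : 𝒮 => ∑ x, (S : Set (Fin t → X)).indicator q x)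
    (Set.finite_range _).bddAbove ⟨S, hS⟩

theorem guessProb_le {c : ℝ} (hc : 0 ≤ c) (h : ∀ S ∈ 𝒮, ∑ x, S.indicator q x ≤ c) :
    guessProb 𝒮 q ≤ c :=
  Real.iSup_le (fun S => h S.1 S.2) hc

theorem guessProb_le_sum (𝒮 : Set (Set (Fin t → X))) (hq : ∀ x, 0 ≤ q x) :
    guessProb 𝒮 q ≤ ∑ x, q x :=
  guessProb_le (Finset.sum_nonneg fun x _ => hq x) fun _ _ =>
    Finset.sum_le_sum fun x _ => Set.indicator_le_self' (fun x _ => hq x) x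

theorem guessProb_const_mul (𝒮 : Set (Set (Fin t → X))) {c : ℝ} (hc : 0 ≤ c)
    (q : (Fin t → X) → ℝ) : guessProb 𝒮 (fun x => c * q x) = c * guessProb 𝒮 q := by
  rw [guessProb, guessProb, Real.mul_iSup_of_nonneg hc]
  refine iSup_congr fun S => ?_
  rw [Finset.mul_sum]
  refine Finset.sum_congr rfl fun x _ => ?_
  by_cases hx : x ∈ (S : Set (Fin t → X)) <;> simp [hx]

theorem guessProb_mono {q' : (Fin t → X) → ℝ} (hq' : ∀ x, 0 ≤ q' x) (h : ∀ x, q x ≤ q' x) :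
    guessProb 𝒮 q ≤ guessProb 𝒮 q' :=
  guessProb_le (guessProb_nonneg 𝒮 hq') fun _ hS =>
    (Finset.sum_le_sum fun x _ => Set.indicator_le_indicator (h x)).trans (le_guessProb hS q')

end Guessing

theorem seqLaw_nonneg {X : Type*} {t : ℕ} {p : X → ℝ} (hp : ∀ a, 0 ≤ p a) (x : Fin t → X) :
    0 ≤ seqLaw p t x :=
  Finset.prod_nonneg fun _ _ => hp _

section Leakage

variable {X : Type*} [Fintype X] {t : ℕ} {Y : Type} {p : X → ℝ}

theorem sum_seqLaw (p : X → ℝ) (t : ℕ) : ∑ x, seqLaw p t x = (∑ a, p a) ^ t :=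
  (Fintype.sum_pow p t).symm

/-- The normalization of the posterior cancels. For a codeword of probability zero the joint law
vanishes as well, so the convention for division by zero is harmless. -/
theorem codewordLaw_mul_guessProb (𝒮 : Set (Set (Fin t → X))) (hp : ∀ a, 0 ≤ p a)
    (W : (Fin t → X) → PMF Y) (y : Y) :
    codewordLaw p W y * guessProb 𝒮 (posteriorLaw p W y) =
      guessProb 𝒮 fun x => seqLaw p t x * (W x y).toReal := by
  have h0 : ∀ x, 0 ≤ seqLaw p t x * (W x y).toReal := fun x =>
    mul_nonneg (seqLaw_nonneg hp x) ENNReal.toReal_nonneg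
  have hc : 0 ≤ codewordLaw p W y := Finset.sum_nonneg fun x _ => h0 x
  rw [← guessProb_const_mul 𝒮 hc]
  congr 1
  funext x
  rcases eq_or_ne (codewordLaw p W y) 0 with h | h
  · rw [h, zero_mul]
    exact ((Finset.sum_eq_zero_iff_of_nonneg fun x _ => h0 x).1 h x (Finset.mem_univ x)).symm
  · exact mul_div_cancel₀ _ h

theorem hasSum_codewordLaw (p : X → ℝ) (W : (Fin t → X) → PMF Y) :
    HasSum (codewordLaw p W) ((∑ a, p a) ^ t) := by
  rw [← sum_seqLaw]
  refine hasSum_sum fun x _ => ?_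
  have h1 : ∑' y, W x y = 1 := (W x).tsum_coe
  have h : HasSum (fun y => (W x y).toReal) 1 := by
    have := ENNReal.hasSum_toReal (f := fun y => W x y) (by rw [h1]; exact ENNReal.one_ne_top)
    rwa [← ENNReal.tsum_toReal_eq fun y => (W x).apply_ne_top y, h1, ENNReal.toReal_one] at this
  simpa using h.mul_left (seqLaw p t x)

theorem posteriorGuessProb_eq (𝒮 : Set (Set (Fin t → X))) (hp : ∀ a, 0 ≤ p a)
    (W : (Fin t → X) → PMF Y) :
    posteriorGuessProb 𝒮 p W = ∑' y, guessProb 𝒮 fun x => seqLaw p t x * (W x y).toReal :=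
  tsum_congr (codewordLaw_mul_guessProb 𝒮 hp W)

theorem guessProb_joint_le (𝒮 : Set (Set (Fin t → X))) (hp : ∀ a, 0 ≤ p a)
    (W : (Fin t → X) → PMF Y) (y : Y) :
    (guessProb 𝒮 fun x => seqLaw p t x * (W x y).toReal) ≤ codewordLaw p W y :=
  guessProb_le_sum 𝒮 fun x => mul_nonneg (seqLaw_nonneg hp x) ENNReal.toReal_nonneg

theorem summable_guessProb_joint (𝒮 : Set (Set (Fin t → X))) (hp : ∀ a, 0 ≤ p a)
    (W : (Fin t → X) → PMF Y) :
    Summable fun y => guessProb 𝒮 fun x => seqLaw p t x * (W x y).toReal :=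
  (hasSum_codewordLaw p W).summable.of_nonneg_of_le
    (fun _ => guessProb_nonneg 𝒮 fun x => mul_nonneg (seqLaw_nonneg hp x) ENNReal.toReal_nonneg)
    (guessProb_joint_le 𝒮 hp W)

theorem posteriorGuessProb_le_one (𝒮 : Set (Set (Fin t → X))) (hp : p ∈ stdSimplex ℝ X)
    (W : (Fin t → X) → PMF Y) : posteriorGuessProb 𝒮 p W ≤ 1 := by
  have h := hasSum_codewordLaw p W
  rw [hp.2, one_pow] at h
  rw [posteriorGuessProb_eq 𝒮 hp.1, ← h.tsum_eq]
  exact (summable_guessProb_joint 𝒮 hp.1 W).tsum_le_tsum (guessProb_joint_le 𝒮 hp.1 W) h.summable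

theorem exists_mem_successSets (Θ : SimpleGraph X) {n : ℕ} (hn : 1 ≤ n)
    (hnX : n ≤ Fintype.card (Fin t → X)) (x : Fin t → X) : ∃ S ∈ successSets Θ t n, x ∈ S := by
  classical
  obtain ⟨K, hK, hc⟩ := Finset.exists_superset_card_eq (s := {x}) (by simpa using hn) hnX
  exact ⟨_, ⟨K, hc, rfl⟩, Set.mem_iUnion₂.2
    ⟨x, hK (Finset.mem_singleton_self x), self_mem_closedNbhd _ x⟩⟩

/-- Every single sequence lies in some success set, so the prior guessing probability dominates each
point mass. This keeps the leakage ratio bounded uniformly in the source, so its supremum is a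
genuine one. -/
theorem one_le_card_mul_guessProb (Θ : SimpleGraph X) {n : ℕ} (hn : 1 ≤ n)
    (hnX : n ≤ Fintype.card (Fin t → X)) (hp : p ∈ stdSimplex ℝ X) :
    1 ≤ Fintype.card (Fin t → X) * guessProb (successSets Θ t n) (seqLaw p t) := by
  calc (1 : ℝ) = ∑ x, seqLaw p t x := by rw [sum_seqLaw, hp.2, one_pow]
    _ ≤ ∑ _x : Fin t → X, guessProb (successSets Θ t n) (seqLaw p t) := by
        refine Finset.sum_le_sum fun x _ => ?_
        obtain ⟨S, hS, hxS⟩ := exists_mem_successSets Θ hn hnX x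
        refine le_trans ?_ (le_guessProb hS _)
        rw [← Set.indicator_of_mem hxS (seqLaw p t)]
        exact Finset.single_le_sum (f := S.indicator (seqLaw p t))
          (fun x _ => Set.indicator_nonneg (fun x _ => seqLaw_nonneg hp.1 x) x)
          (Finset.mem_univ x)
    _ = _ := by simp

theorem guessProb_seqLaw_pos (Θ : SimpleGraph X) {n : ℕ} (hn : 1 ≤ n)
    (hnX : n ≤ Fintype.card (Fin t → X)) (hp : p ∈ stdSimplex ℝ X) :
    0 < guessProb (successSets Θ t n) (seqLaw p t) := by
  have h := one_le_card_mul_guessProb Θ hn hnX hp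
  by_contra! h0
  have : (Fintype.card (Fin t → X) : ℝ) * guessProb (successSets Θ t n) (seqLaw p t) ≤ 0 :=
    mul_nonpos_of_nonneg_of_nonpos (Nat.cast_nonneg _) h0
  linarith

theorem bddAbove_leakage_ratio (Θ : SimpleGraph X) {n : ℕ} (hn : 1 ≤ n)
    (hnX : n ≤ Fintype.card (Fin t → X)) (W : (Fin t → X) → PMF Y) :
    BddAbove (Set.range fun p : stdSimplex ℝ X =>
      posteriorGuessProb (successSets Θ t n) p W /
        guessProb (successSets Θ t n) (seqLaw p t)) := by
  refine ⟨Fintype.card (Fin t → X), ?_⟩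
  rintro _ ⟨p, rfl⟩
  exact (div_le_iff₀ (guessProb_seqLaw_pos Θ hn hnX p.2)).2
    ((posteriorGuessProb_le_one _ p.2 W).trans (one_le_card_mul_guessProb Θ hn hnX p.2))

theorem le_leakage (Θ : SimpleGraph X) {n : ℕ} (hn : 1 ≤ n)
    (hnX : n ≤ Fintype.card (Fin t → X)) (W : (Fin t → X) → PMF Y) (hp : p ∈ stdSimplex ℝ X)
    {c : ℝ} (hc : 0 < c) (h : c * guessProb (successSets Θ t n) (seqLaw p t) ≤
      posteriorGuessProb (successSets Θ t n) p W) :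
    Real.logb 2 c ≤ leakage W (successSets Θ t n) := by
  refine Real.logb_le_logb_of_le one_lt_two hc ?_
  refine le_trans ?_ (le_ciSup (bddAbove_leakage_ratio Θ hn hnX W) ⟨p, hp⟩)
  exact (le_div_iff₀ (guessProb_seqLaw_pos Θ hn hnX hp)).2 h

theorem leakage_le (Θ : SimpleGraph X) {n : ℕ} (hn : 1 ≤ n)
    (hnX : n ≤ Fintype.card (Fin t → X)) (W : (Fin t → X) → PMF Y) {c : ℝ} (hc : 1 ≤ c)
    (h : ∀ p ∈ stdSimplex ℝ X, posteriorGuessProb (successSets Θ t n) p W ≤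
      c * guessProb (successSets Θ t n) (seqLaw p t)) :
    leakage W (successSets Θ t n) ≤ Real.logb 2 c := by
  have hle : (⨆ p : stdSimplex ℝ X, posteriorGuessProb (successSets Θ t n) p W /
      guessProb (successSets Θ t n) (seqLaw p t)) ≤ c :=
    Real.iSup_le (fun p => (div_le_iff₀ (guessProb_seqLaw_pos Θ hn hnX p.2)).2 (h p p.2))
      (zero_le_one.trans hc)
  rw [leakage]
  rcases lt_or_ge 0 (⨆ p : stdSimplex ℝ X, posteriorGuessProb (successSets Θ t n) p W /
      guessProb (successSets Θ t n) (seqLaw p t)) with h0 | h0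
  · exact Real.logb_le_logb_of_le one_lt_two h0 hle
  · have h1 : 0 ≤ ⨆ p : stdSimplex ℝ X, posteriorGuessProb (successSets Θ t n) p W /
        guessProb (successSets Θ t n) (seqLaw p t) := by
      refine Real.iSup_nonneg fun p => div_nonneg ?_ (guessProb_seqLaw_pos Θ hn hnX p.2).le
      rw [posteriorGuessProb_eq (p := p) _ p.2.1]
      exact tsum_nonneg fun y => guessProb_nonneg _ fun x =>
        mul_nonneg (seqLaw_nonneg p.2.1 x) ENNReal.toReal_nonneg
    -- If the supremum is `0`, its logarithm is `0` by convention; the bound then rests on `1 ≤ c`.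
    rw [le_antisymm h0 h1, Real.logb_zero]
    exact Real.logb_nonneg one_lt_two hc

/-! ### The two bounds on the leakage of mapping schemes -/

/-- The random product coloring is a valid mapping scheme of small leakage. -/
theorem exists_valid_leakage_le [Nonempty X] (Γ Θ : SimpleGraph X) (b : ℕ+) {n : ℕ} (hn : 1 ≤ n)
    (hnX : n ≤ Fintype.card (Fin t → X)) :
    ∃ (Y : Type) (W : (Fin t → X) → PMF Y), IsValid Γ W ∧ leakage W (successSets Θ t n) ≤
      Real.logb 2 (((foldChromaticNumber Γ b : ℝ) / (b : ℕ)) ^ t) := by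
  classical
  obtain ⟨A, hA, hcard⟩ := exists_coloring_family Γ b
  have hb0 : (0 : ℝ) < (b : ℕ) := by exact_mod_cast b.pos
  -- The tuples of classes compatible with `x`; there are exactly `b ^ t` of them, whatever `x` is.
  let F : (Fin t → X) → Finset (Fin t → Fin (foldChromaticNumber Γ b)) := fun x =>
    Fintype.piFinset fun j => Finset.univ.filter fun i => x j ∈ A i
  have hF : ∀ x, (F x).card = (b : ℕ) ^ t := fun x => by
    simp only [F, Fintype.card_piFinset, hcard, Finset.prod_const, Finset.card_univ,
      Fintype.card_fin]
  have hne : ∀ x, (F x).Nonempty := fun x => Finset.card_pos.1 (by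
    rw [hF]
    exact pow_pos b.pos t)
  let W : (Fin t → X) → PMF (Fin t → Fin (foldChromaticNumber Γ b)) := fun x =>
    PMF.uniformOfFinset (F x) (hne x)
  have hW : ∀ x y, (W x y).toReal ≤ (((b : ℕ) : ℝ) ^ t)⁻¹ := fun x y => by
    simp only [W, PMF.uniformOfFinset_apply, hF]
    split_ifs
    · simp
    · simp
  refine ⟨_, W, fun y x hx v hv _ => ?_, ?_⟩
  · rintro ⟨j, hj⟩
    have mem : ∀ x, 0 < W x y → x j ∈ A (y j) := fun x hx => by
      have h1 : y ∈ F x := (PMF.mem_support_uniformOfFinset_iff (hne x) y).1 hx.ne'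
      simpa using Fintype.mem_piFinset.1 h1 j
    exact hA (y j) (mem x hx) (mem v hv) hj.ne hj
  · refine leakage_le Θ hn hnX W (one_le_pow₀ ?_) fun p hp => ?_
    · rw [one_le_div hb0]
      exact_mod_cast le_foldChromaticNumber Γ b
    · rw [posteriorGuessProb_eq _ hp.1, tsum_fintype]
      calc ∑ y, (guessProb (successSets Θ t n) fun x => seqLaw p t x * (W x y).toReal)
          ≤ ∑ _y : Fin t → Fin (foldChromaticNumber Γ b),
            (((b : ℕ) : ℝ) ^ t)⁻¹ * guessProb (successSets Θ t n) (seqLaw p t) := by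
            refine Finset.sum_le_sum fun y _ => ?_
            rw [← guessProb_const_mul _ (by positivity)]
            refine guessProb_mono (fun x => mul_nonneg (by positivity) (seqLaw_nonneg hp.1 x))
              fun x => ?_
            rw [mul_comm]
            exact mul_le_mul_of_nonneg_right (hW x y) (seqLaw_nonneg hp.1 x)
        _ = _ := by
            simp only [Finset.sum_const, Finset.card_univ, Fintype.card_pi, Fintype.card_fin,
              Finset.prod_const, nsmul_eq_mul, Nat.cast_pow, div_pow]
            ring

/-- Every valid mapping scheme leaks at least the logarithm of the ratio of a packing of the
sequences and a bound on their covering numbers. -/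
theorem le_leakage_of_isValid [Nonempty X] {Γ Θ : SimpleGraph X} {M : ℝ}
    (hM : maxFracCoveringNumber Γ Θ < M) {n k : ℕ}
    (hn : M ^ t * (t * Real.log (Fintype.card X)) < n) (hk : 1 ≤ k)
    (hkcov : k ≤ maxCoveringNumber (orPower Γ t) (andPower Θ t)) {w : X → ℝ}
    (hw : ∀ x, 0 ≤ w x) (hpack : ∀ x, ∑ v, (closedNbhd Θ x).indicator w v ≤ 1)
    (hs : 0 < ∑ x, w x) {W : (Fin t → X) → PMF Y} (hW : IsValid Γ W) :
    Real.logb 2 ((∑ x, w x) ^ t / n) ≤ leakage W (successSets Θ t k) := by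
  classical
  set s := ∑ x, w x with hsdef
  have hcov := fun S (hS : (orPower Γ t).IsIndepSet S) => exists_cover_orPower Γ Θ hM hn hS
  have hkn : k ≤ n := hkcov.trans (maxCoveringNumber_le _ _ hcov)
  have hkX : k ≤ Fintype.card (Fin t → X) := hkcov.trans (maxCoveringNumber_le_card _ _)
  have hn0 : (0 : ℝ) < n := by exact_mod_cast hk.trans hkn
  have hst : 0 < s ^ t := pow_pos hs t
  -- The packing normalized to a source law: every closed neighborhood has mass at most `s⁻¹`.
  let p : X → ℝ := fun x => s⁻¹ * w x
  have hp : p ∈ stdSimplex ℝ X :=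
    ⟨fun x => mul_nonneg (inv_nonneg.2 hs.le) (hw x), by
      rw [← Finset.mul_sum, ← hsdef, inv_mul_cancel₀ hs.ne']⟩
  refine le_leakage Θ hk hkX W hp (div_pos hst hn0) ?_
  have hprior : guessProb (successSets Θ t k) (seqLaw p t) ≤ k * (s ^ t)⁻¹ := by
    refine guessProb_le (by positivity) ?_
    rintro _ ⟨K, hK, rfl⟩
    have hball : ∀ z : Fin t → X,
        ∑ x, (closedNbhd (andPower Θ t) z).indicator (seqLaw p t) x ≤ (s ^ t)⁻¹ := fun z => by
      rw [closedNbhd_andPower]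
      refine (sum_indicator_pi (fun j => closedNbhd Θ (z j)) fun _ => p).trans_le ?_
      calc ∏ j, ∑ a, (closedNbhd Θ (z j)).indicator p a ≤ ∏ _j : Fin t, s⁻¹ := by
            refine Finset.prod_le_prod (fun j _ => Finset.sum_nonneg fun a _ =>
              Set.indicator_nonneg (fun a _ => hp.1 a) a) fun j _ => ?_
            have : ∀ a, (closedNbhd Θ (z j)).indicator p a =
                s⁻¹ * (closedNbhd Θ (z j)).indicator w a := fun a => by
              by_cases ha : a ∈ closedNbhd Θ (z j) <;> simp [ha, p]
            simp only [this]
            rw [← Finset.mul_sum]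
            exact mul_le_of_le_one_right (inv_nonneg.2 hs.le) (hpack _)
        _ = (s ^ t)⁻¹ := by simp
    calc ∑ x, (⋃ z ∈ K, closedNbhd (andPower Θ t) z).indicator (seqLaw p t) x
        ≤ ∑ x, ∑ z ∈ K, (closedNbhd (andPower Θ t) z).indicator (seqLaw p t) x := by
          refine Finset.sum_le_sum fun x _ => ?_
          have h0 : ∀ z ∈ K, 0 ≤ (closedNbhd (andPower Θ t) z).indicator (seqLaw p t) x :=
            fun z _ => Set.indicator_nonneg (fun x _ => seqLaw_nonneg hp.1 x) x
          refine Set.indicator_apply_le' (fun hx => ?_) fun _ => Finset.sum_nonneg h0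
          obtain ⟨z, hz, hxz⟩ := Set.mem_iUnion₂.1 hx
          rw [← Set.indicator_of_mem hxz (seqLaw p t)]
          exact Finset.single_le_sum h0 hz
      _ = ∑ z ∈ K, ∑ x, (closedNbhd (andPower Θ t) z).indicator (seqLaw p t) x :=
          Finset.sum_comm
      _ ≤ ∑ _z ∈ K, (s ^ t)⁻¹ := Finset.sum_le_sum fun z _ => hball z
      _ = k * (s ^ t)⁻¹ := by rw [Finset.sum_const, hK, nsmul_eq_mul]
  have hpost : (k : ℝ) / n ≤ posteriorGuessProb (successSets Θ t k) p W := by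
    have h1 := hasSum_codewordLaw p W
    rw [hp.2, one_pow] at h1
    have h2 := h1.mul_left ((k : ℝ) / n)
    rw [mul_one] at h2
    rw [posteriorGuessProb_eq _ hp.1, ← h2.tsum_eq]
    refine h2.summable.tsum_le_tsum (fun y => ?_) (summable_guessProb_joint _ hp.1 W)
    -- Validity makes the support of each codeword independent, so `n` neighborhoods cover it and
    -- the best `k` keep a fraction `k / n` of its mass.
    obtain ⟨K, hKn, hK⟩ := hcov _ (hW y)
    obtain ⟨K', hK', hle⟩ := exists_card_eq_mul_sum_le (andPower Θ t)
      (q := fun x => seqLaw p t x * (W x y).toReal)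
      (fun x => mul_nonneg (seqLaw_nonneg hp.1 x) ENNReal.toReal_nonneg) hKn hkn hkX
      fun v hv => hK v (show 0 < W v y from pos_iff_ne_zero.2 fun h => hv (by simp [h]))
    have hS : (⋃ z ∈ K', closedNbhd (andPower Θ t) z) ∈ successSets Θ t k := ⟨K', hK', rfl⟩
    refine le_trans ?_ (le_guessProb hS _)
    rw [div_mul_eq_mul_div, div_le_iff₀ hn0, mul_comm _ (n : ℝ)]
    exact hle
  calc s ^ t / n * guessProb (successSets Θ t k) (seqLaw p t)
      ≤ s ^ t / n * (k * (s ^ t)⁻¹) := mul_le_mul_of_nonneg_left hprior (by positivity)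
    _ = k / n := by field_simp
    _ ≤ _ := hpost

end Leakage

/-! ### Rates -/

theorem IsGuessingCapability.le_card {X : Type*} [Fintype X] {Γ Θ : SimpleGraph X}
    {g : ℕ → ℕ} (hg : IsGuessingCapability Γ Θ g) {t : ℕ} (ht : 1 ≤ t) :
    g t ≤ Fintype.card (Fin t → X) :=
  (hg.le_covering t ht).trans (maxCoveringNumber_le_card _ _)

section Rate

variable {X : Type*} [Fintype X] [Nonempty X] {Γ Θ : SimpleGraph X} {g : ℕ → ℕ}

theorem exists_packing (Θ : SimpleGraph X) : ∃ w : X → ℝ, (∀ x, 0 ≤ w x ∧ w x ≤ 1) ∧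
    (∀ x, ∑ v, (closedNbhd Θ x).indicator w v ≤ 1) ∧ 1 = ∑ x, w x := by
  classical
  obtain ⟨a⟩ := ‹Nonempty X›
  have hw : ∀ x, 0 ≤ (Pi.single a 1 : X → ℝ) x ∧ (Pi.single a 1 : X → ℝ) x ≤ 1 := fun x => by
    by_cases h : x = a
    · subst h
      simp
    · simp [h]
  have hsum : ∑ x, (Pi.single a 1 : X → ℝ) x = 1 := by simp
  refine ⟨Pi.single a 1, hw, fun x => ?_, hsum.symm⟩
  refine le_of_le_of_eq ?_ hsum
  exact Finset.sum_le_sum fun v _ => Set.indicator_le_self' (fun x _ => (hw x).1) v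

theorem one_le_fracPackingNumber (Θ : SimpleGraph X) : 1 ≤ fracPackingNumber Θ := by
  refine le_csSup ⟨Fintype.card X, ?_⟩ (exists_packing Θ)
  rintro _ ⟨w, hw, -, rfl⟩
  calc ∑ x, w x ≤ ∑ _x : X, (1 : ℝ) := Finset.sum_le_sum fun x _ => (hw x).2
    _ = Fintype.card X := by simp

theorem exists_packing_gt (Θ : SimpleGraph X) {c : ℝ} (hc : c < fracPackingNumber Θ) :
    ∃ w : X → ℝ, (∀ x, 0 ≤ w x) ∧ (∀ x, ∑ v, (closedNbhd Θ x).indicator w v ≤ 1) ∧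
      c < ∑ x, w x := by
  obtain ⟨_, ⟨w, hw, hpack, rfl⟩, h⟩ := exists_lt_of_lt_csSup ⟨1, exists_packing Θ⟩ hc
  exact ⟨w, fun x => (hw x).1, hpack, h⟩

theorem le_optLeakage (hg : IsGuessingCapability Γ Θ g) {t : ℕ} (ht : 1 ≤ t) {M : ℝ}
    (hM : maxFracCoveringNumber Γ Θ < M) {n : ℕ}
    (hn : M ^ t * (t * Real.log (Fintype.card X)) < n) {w : X → ℝ}
    (hw : ∀ x, 0 ≤ w x) (hpack : ∀ x, ∑ v, (closedNbhd Θ x).indicator w v ≤ 1)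
    (hs : 0 < ∑ x, w x) : Real.logb 2 ((∑ x, w x) ^ t / n) ≤ optLeakage Γ Θ g t := by
  -- Any valid scheme will do: it shows that the set under the infimum is nonempty.
  obtain ⟨Y, W, hW, -⟩ := exists_valid_leakage_le Γ Θ 1 (hg.pos t ht) (hg.le_card ht)
  refine le_csInf ⟨_, Y, W, hW, rfl⟩ ?_
  rintro _ ⟨Y, W, hW, rfl⟩
  exact le_leakage_of_isValid hM hn (hg.pos t ht) (hg.le_covering t ht) hw hpack hs hW

theorem optLeakage_le (hg : IsGuessingCapability Γ Θ g) {t : ℕ} (ht : 1 ≤ t) (b : ℕ+) :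
    optLeakage Γ Θ g t ≤ t * Real.logb 2 ((foldChromaticNumber Γ b : ℝ) / (b : ℕ)) := by
  obtain ⟨Y, W, hW, hle⟩ := exists_valid_leakage_le Γ Θ b (hg.pos t ht) (hg.le_card ht)
  rw [Real.logb_pow] at hle
  suffices h : BddBelow {r | ∃ (Y : Type) (W : (Fin t → X) → PMF Y), IsValid Γ W ∧
      r = leakage W (successSets Θ t (g t))} from (csInf_le h ⟨Y, W, hW, rfl⟩).trans hle
  -- The infimum is meaningful only for a set bounded below; a crude case of the lower bound, with a
  -- packing of weight `1` and `M` one above the covering constant, suffices.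
  obtain ⟨w, hw, hpack, hs⟩ := exists_packing Θ
  refine ⟨Real.logb 2 ((∑ x, w x) ^ t / (⌊(maxFracCoveringNumber Γ Θ + 1) ^ t *
    (t * Real.log (Fintype.card X))⌋₊ + 1 : ℕ)), ?_⟩
  rintro _ ⟨Y, W, hW, rfl⟩
  exact le_leakage_of_isValid (lt_add_one _) (Nat.lt_floor_add_one _ |>.trans_eq
    (Nat.cast_succ _).symm) (hg.pos t ht) (hg.le_covering t ht) (fun x => (hw x).1) hpack
    (hs ▸ one_pos) hW

theorem normLeakage_le (hg : IsGuessingCapability Γ Θ g) {t : ℕ} (ht : 1 ≤ t) :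
    normLeakage Γ Θ g t ≤ Real.logb 2 (fracChromaticNumber Γ) := by
  have ht0 : (0 : ℝ) < t := by exact_mod_cast ht
  have hratio : ∀ b : ℕ+, 1 ≤ (foldChromaticNumber Γ b : ℝ) / (b : ℕ) := fun b => by
    rw [one_le_div (by exact_mod_cast b.pos)]
    exact_mod_cast le_foldChromaticNumber Γ b
  have hpos : 0 < fracChromaticNumber Γ := one_pos.trans_le (le_ciInf hratio)
  -- In exponential form the bounds for the individual `b` pass directly to the infimum.
  rw [Real.le_logb_iff_rpow_le one_lt_two hpos]
  refine le_ciInf fun b => ?_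
  rw [← Real.le_logb_iff_rpow_le one_lt_two (one_pos.trans_le (hratio b)), normLeakage,
    inv_mul_le_iff₀ ht0]
  exact optLeakage_le hg ht b

/-- The gap below the target is `3δ`: one `δ` pays for a near-optimal packing, one for taking `M`
above the covering constant, and one for the `O(log t) / t` cost of rounding the fractional
covering. -/
theorem eventually_le_normLeakage (hg : IsGuessingCapability Γ Θ g) {a : ℝ}
    (ha : a < Real.logb 2 (fracPackingNumber Θ / maxFracCoveringNumber Γ Θ)) :
    ∀ᶠ t in atTop, a ≤ normLeakage Γ Θ g t := by
  have hp1 := one_le_fracPackingNumber Θ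
  have hκ1 := one_le_maxFracCoveringNumber Γ Θ
  set κ := maxFracCoveringNumber Γ Θ
  set δ := (Real.logb 2 (fracPackingNumber Θ / κ) - a) / 3 with hδ
  have hδ0 : 0 < δ := by
    rw [hδ]
    linarith
  have hr : (1 : ℝ) < 2 ^ δ := Real.one_lt_rpow one_lt_two hδ0
  obtain ⟨w, hw, hpack, hs⟩ := exists_packing_gt Θ
    (div_lt_self (one_pos.trans_le hp1) hr)
  have hM : κ < κ * 2 ^ δ := lt_mul_of_one_lt_right (by linarith) hr
  set M := κ * 2 ^ δ with hMdef
  set s := ∑ x, w x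
  have hs0 : 0 < s := lt_trans (by positivity) hs
  have hM1 : 1 ≤ M := by linarith
  have hlogM : Real.logb 2 M = Real.logb 2 κ + δ := by
    rw [hMdef, Real.logb_mul (by positivity) (by positivity), Real.logb_rpow two_pos (by norm_num)]
  have hlogs : Real.logb 2 (fracPackingNumber Θ) - δ ≤ Real.logb 2 s := by
    rw [← Real.logb_rpow two_pos (by norm_num : (2 : ℝ) ≠ 1) (x := δ),
      ← Real.logb_div (by positivity) (by positivity)]
    exact Real.logb_le_logb_of_le one_lt_two (by positivity) hs.le
  rw [Real.logb_div (by positivity) (by positivity)] at hδ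
  set C := Real.log (Fintype.card X) with hC
  have hC0 : 0 ≤ C := Real.log_natCast_nonneg _
  have herr : Tendsto (fun t : ℕ => (Real.log t + Real.log (C + 1)) / Real.log 2 / t) atTop
      (𝓝 0) := by
    have h1 : Tendsto (fun t : ℕ => Real.log t / (t : ℝ)) atTop (𝓝 0) := by
      have := (Real.tendsto_pow_log_div_mul_add_atTop 1 0 1 one_ne_zero).comp
        (tendsto_natCast_atTop_atTop (R := ℝ))
      simpa [Function.comp_def] using this
    have h2 : Tendsto (fun t : ℕ => Real.log (C + 1) / (t : ℝ)) atTop (𝓝 0) :=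
      tendsto_const_div_atTop_nhds_zero_nat _
    have h3 := (h1.add h2).div_const (Real.log 2)
    rw [add_zero, zero_div] at h3
    refine h3.congr fun t => ?_
    rw [← add_div, div_right_comm]
  filter_upwards [eventually_ge_atTop 1, herr.eventually_le_const hδ0] with t ht hsmall
  have ht0 : (0 : ℝ) < t := by exact_mod_cast ht
  have ht1 : (1 : ℝ) ≤ t := by exact_mod_cast ht
  set n := ⌊M ^ t * (t * C)⌋₊ + 1 with hn
  have hn1 : M ^ t * (t * C) < n := by
    rw [hn, Nat.cast_succ]
    exact Nat.lt_floor_add_one _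
  have hMt : 1 ≤ M ^ t := one_le_pow₀ hM1
  -- The `+ 1` of rounding is absorbed using `1 ≤ M ^ t * t`; working with `C + 1` also keeps the
  -- logarithm sound for a one-letter alphabet, where `C = 0`.
  have hn2 : (n : ℝ) ≤ M ^ t * (t * (C + 1)) := by
    have h1 : (⌊M ^ t * (t * C)⌋₊ : ℝ) ≤ M ^ t * (t * C) := Nat.floor_le (by positivity)
    have h2 : 1 * 1 ≤ M ^ t * t := mul_le_mul hMt ht1 zero_le_one (by linarith)
    rw [hn, Nat.cast_succ]
    linarith
  have hn0 : (0 : ℝ) < n := by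
    rw [hn]
    positivity
  have hlogn : Real.logb 2 n ≤
      t * Real.logb 2 M + (Real.log t + Real.log (C + 1)) / Real.log 2 := by
    refine (Real.logb_le_logb_of_le one_lt_two hn0 hn2).trans_eq ?_
    rw [Real.logb_mul (by positivity) (by positivity), Real.logb_pow,
      Real.logb_mul ht0.ne' (by positivity), add_div]
    rfl
  have hmain := le_optLeakage hg ht hM hn1 hw hpack hs0
  rw [Real.logb_div (by positivity) hn0.ne', Real.logb_pow] at hmain
  rw [normLeakage, le_inv_mul_iff₀ ht0]
  rw [div_le_iff₀ ht0] at hsmall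
  have hfin : (t : ℝ) * a ≤ t * (Real.logb 2 s - Real.logb 2 M - δ) :=
    mul_le_mul_of_nonneg_left (by linarith) ht0.le
  linarith

end Rate

end ZeroErrorLeakage

/-! ### Asymptotic bounds on the leakage rate -/

theorem theorem4 {X : Type*} [Fintype X] [Nonempty X] (Γ Θ : SimpleGraph X) (g : ℕ → ℕ)
    (hg : ZeroErrorLeakage.IsGuessingCapability Γ Θ g) :
    (((Real.logb 2 (ZeroErrorLeakage.fracPackingNumber Θ /
          ZeroErrorLeakage.maxFracCoveringNumber Γ Θ) : ℝ) : EReal) ≤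
        Filter.liminf (fun t => ((ZeroErrorLeakage.normLeakage Γ Θ g t : ℝ) : EReal))
          Filter.atTop ∧
      Filter.limsup (fun t => ((ZeroErrorLeakage.normLeakage Γ Θ g t : ℝ) : EReal))
          Filter.atTop ≤
        ((Real.logb 2 (ZeroErrorLeakage.fracChromaticNumber Γ) : ℝ) : EReal)) ∧
    ∀ L : ℝ, ZeroErrorLeakage.IsLeakageRate Γ Θ g L →
      Real.logb 2 (ZeroErrorLeakage.fracPackingNumber Θ /
          ZeroErrorLeakage.maxFracCoveringNumber Γ Θ) ≤ L ∧
        L ≤ Real.logb 2 (ZeroErrorLeakage.fracChromaticNumber Γ) := by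
  have hlow := fun a ha => ZeroErrorLeakage.eventually_le_normLeakage hg (a := a) ha
  have hup : ∀ᶠ t in atTop, ZeroErrorLeakage.normLeakage Γ Θ g t ≤
      Real.logb 2 (ZeroErrorLeakage.fracChromaticNumber Γ) := by
    filter_upwards [eventually_ge_atTop 1] with t ht
    exact ZeroErrorLeakage.normLeakage_le hg ht
  refine ⟨⟨?_, ?_⟩, fun L hL => ⟨?_, ?_⟩⟩
  -- The lower bound is known only eventually and for each real `a` strictly below the target, so it
  -- is tested against all such `a`.
  · refine EReal.ge_of_forall_gt_iff_ge.1 fun a ha => ?_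
    refine le_liminf_of_le (by isBoundedDefault) ?_
    filter_upwards [hlow a (EReal.coe_lt_coe_iff.1 ha)] with t ht
    exact EReal.coe_le_coe_iff.2 ht
  · refine limsup_le_of_le (by isBoundedDefault) ?_
    filter_upwards [hup] with t ht
    exact EReal.coe_le_coe_iff.2 ht
  · exact le_of_forall_lt_imp_le_of_dense fun a ha => ge_of_tendsto hL (hlow a ha)
  · exact le_of_tendsto hL hup
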